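/- For a compact abelian group $G$ with normalized Haar measure $\mu$ and (multiplicative) group $\widehat G$ of continuous characters, let $\mathbb{Z}[\widehat G]$ be the ring of integral combinations of characters of $G$. For $f\in\mathbb{Z}[\widehat G]$ let $$\mathsf{m}_G(f)=\int_G\log|f|\,d\mu\in[-\infty,\infty)\qquad(\log 0=-\infty)$$ be its logarithmic Mahler measure over $G$, and let $$\lambda(G)=\inf\{\,\mathsf{m}_G(f): f\in\mathbb{Z}[\widehat G],\ \mathsf{m}_G(f)>0\,\}$$ be the Lehmer constant of $G$. Let $\mathbb{T}=\mathbb{R}/\mathbb{Z}$. Then $\lambda(\mathbb{T}^k)=\lambda(\mathbb{T})$ for every integer $k\ge 1$. -/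

import Mathlib

open MeasureTheory

noncomputable section

namespace LehmerConstant

/-- The multiplicative group `Ĝ` of continuous characters of a (here additively written)
topological abelian group `G`. -/
abbrev Dual (G : Type*) [AddCommGroup G] [TopologicalSpace G] : Type _ :=
  PontryaginDual (Multiplicative G)

/-- The ring `ℤ[Ĝ]` of integral combinations of characters of `G`. -/
abbrev IntCharRing (G : Type*) [AddCommGroup G] [TopologicalSpace G] : Type _ :=
  MonoidAlgebra ℤ (Dual G)

/-- The complex-valued function on `G` given by an integral combination of characters:
`x ↦ ∑ n_χ χ(x)`. -/
def evalAt {G : Type*} [AddCommGroup G] [TopologicalSpace G] (f : IntCharRing G) (x : G) : ℂ :=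
  f.coeff.sum fun χ n => (n : ℂ) * (χ (Multiplicative.ofAdd x) : ℂ)

/-- The normalized Haar measure on a compact abelian group: the Haar measure giving the
whole group mass `1`. -/
def normalizedHaar (G : Type*) [AddCommGroup G] [TopologicalSpace G] [IsTopologicalAddGroup G]
    [CompactSpace G] [MeasurableSpace G] [BorelSpace G] : Measure G :=
  Measure.addHaarMeasure ⊤

/-- The integral of an extended-real-valued function, as the integral of its positive part minus
the integral of its negative part. It is the usual integral, with value in `[-∞, ∞]`, whenever
the function is measurable and one of the two parts has a finite integral. -/
def extendedIntegral {X : Type*} [MeasurableSpace X] (μ : Measure X) (g : X → EReal) : EReal :=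
  ((∫⁻ x, (g x).toENNReal ∂μ : ENNReal) : EReal) - ((∫⁻ x, (-g x).toENNReal ∂μ : ENNReal) : EReal)

/-- The logarithmic Mahler measure `m_G(f) = ∫_G log |f| dμ`, with `log 0 = -∞`. The positive part
of the integrand is bounded, so that the value lies in `[-∞, ∞)`. -/
def logMahler {G : Type*} [AddCommGroup G] [TopologicalSpace G] [IsTopologicalAddGroup G]
    [CompactSpace G] [MeasurableSpace G] [BorelSpace G] (f : IntCharRing G) : EReal :=
  extendedIntegral (normalizedHaar G) fun x => ENNReal.log ‖evalAt f x‖ₑ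

/-- The Lehmer constant `λ(G) = inf {m_G(f) : f ∈ ℤ[Ĝ], m_G(f) > 0}`. -/
def lehmerConst (G : Type*) [AddCommGroup G] [TopologicalSpace G] [IsTopologicalAddGroup G]
    [CompactSpace G] [MeasurableSpace G] [BorelSpace G] : EReal :=
  sInf {m : EReal | ∃ f : IntCharRing G, logMahler f = m ∧ 0 < m}

end LehmerConstant

end

/-! Pulling back along a coordinate projection preserves Haar measure, hence Mahler measure, so
every value attained over the circle is attained over the torus. For the converse, the Boyd–Lawton
limit is used: for `f ≠ 0`, the Mahler measure of `f` is the limit of those of its restrictions to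
`t ↦ (t, N t, N² t, …)`. If the limit is positive, the restrictions eventually have positive
measure, so each is at least the Lehmer constant of the circle, and so is the limit.

The curves equidistribute (`tendsto_integral_curve`), which settles the positive part of `log |f|`.
The negative part is unbounded near the zeros of `f` and needs uniform integrability. This comes
from `trigSum.exists_volume_sublevel_le`: an exponential sum with a given number of terms and some
coefficient of modulus at least 1 is smaller than `y` on a set of measure at most `C * y ^ α`,
whatever its frequencies. The proof is by induction on the number of terms: after a shift of
frequencies, differentiation kills one term, and where the derivative is large the sum cannot stay
small for long. -/

/-! ### Sublevel sets of exponential sums -/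

/-- The exponential sum `t ↦ ∑ a i * exp (2 π i n i t)`. -/
noncomputable def trigSum {ι : Type*} (s : Finset ι) (a : ι → ℂ) (n : ι → ℤ) (t : ℝ) : ℂ :=
  ∑ i ∈ s, a i * Complex.exp (2 * Real.pi * Complex.I * n i * t)

namespace trigSum

variable {ι : Type*} (s : Finset ι) (a : ι → ℂ) (n : ι → ℤ)

theorem hasDerivAt (t : ℝ) :
    HasDerivAt (trigSum s a n)
      (trigSum s (fun i => 2 * Real.pi * Complex.I * n i * a i) n t) t := by
  unfold trigSum
  refine HasDerivAt.fun_sum fun i _ => ?_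
  have h1 : HasDerivAt (fun t : ℝ => 2 * Real.pi * Complex.I * n i * (t : ℂ))
      (2 * Real.pi * Complex.I * n i * 1) t :=
    (Complex.ofRealCLM.hasDerivAt (x := t)).const_mul _
  exact (h1.cexp.const_mul (a i)).congr_deriv (by ring)

theorem hasDerivAt_re (t : ℝ) :
    HasDerivAt (fun t => (trigSum s a n t).re)
      (trigSum s (fun i => 2 * Real.pi * Complex.I * n i * a i) n t).re t :=
  Complex.reCLM.hasFDerivAt.comp_hasDerivAt t (hasDerivAt s a n t)

theorem continuous : Continuous (trigSum s a n) := by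
  unfold trigSum; fun_prop

theorem const_mul (c : ℂ) (t : ℝ) :
    trigSum s (fun i => c * a i) n t = c * trigSum s a n t := by
  simp [trigSum, Finset.mul_sum, mul_assoc]

theorem shift (l : ℤ) (t : ℝ) :
    trigSum s a (fun i => n i - l) t =
      Complex.exp (2 * Real.pi * Complex.I * (-l) * t) * trigSum s a n t := by
  rw [trigSum, trigSum, Finset.mul_sum]
  refine Finset.sum_congr rfl fun i _ => ?_
  rw [mul_left_comm, ← Complex.exp_add]
  congr 2
  push_cast
  ring

theorem norm_shift (l : ℤ) (t : ℝ) :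
    ‖trigSum s a (fun i => n i - l) t‖ = ‖trigSum s a n t‖ := by
  rw [shift, norm_mul]
  have : (2 * Real.pi * Complex.I * (-l) * t : ℂ) = ((2 * Real.pi * (-l) * t : ℝ) : ℂ) *
      Complex.I := by push_cast; ring
  rw [this, Complex.norm_exp_ofReal_mul_I, one_mul]

open Polynomial in
/-- The real part of an exponential sum of degree at most `D` vanishes identically or has at most
`2 * D` zeros in a period. -/
theorem re_zeros (D : ℕ) (hD : ∀ i ∈ s, |n i| ≤ D) :
    (∀ t, (trigSum s a n t).re = 0) ∨
      ∃ Z : Finset ℝ, Z.card ≤ 2 * D ∧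
        ∀ t ∈ Set.Ioc (0 : ℝ) 1, (trigSum s a n t).re = 0 → t ∈ Z := by
  classical
  let e : ℝ → ℂ := fun t => Complex.exp (2 * Real.pi * Complex.I * t)
  -- With `z = e t`, twice the real part of the sum is the sum plus its conjugate; multiplying by `z
  -- ^ D` clears the negative powers and leaves a polynomial of degree at most `2 * D`.
  let P : ℂ[X] := ∑ i ∈ s, (C (a i) * X ^ (D + n i).toNat +
    C (starRingEnd ℂ (a i)) * X ^ (D - n i).toNat)
  have he : ∀ t, e t ≠ 0 := fun t => Complex.exp_ne_zero _
  have hpow : ∀ (m : ℤ), 0 ≤ m → ∀ t : ℝ,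
      e t ^ m.toNat = Complex.exp (2 * Real.pi * Complex.I * m * t) := by
    intro m hm t
    rw [← Complex.exp_nat_mul]
    congr 1
    have : ((m.toNat : ℕ) : ℂ) = (m : ℂ) := by
      rw [← Int.cast_natCast, Int.toNat_of_nonneg hm]
    rw [this]; ring
  have hP : ∀ t : ℝ, P.eval (e t) = e t ^ D * (2 * ((trigSum s a n t).re : ℂ)) := by
    intro t
    have h2 : (2 * ((trigSum s a n t).re : ℂ)) =
        trigSum s a n t + starRingEnd ℂ (trigSum s a n t) := by
      rw [Complex.add_conj]; push_cast; ring
    rw [h2, trigSum, map_sum, ← Finset.sum_add_distrib, Finset.mul_sum, eval_finsetSum]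
    refine Finset.sum_congr rfl fun i hi => ?_
    have := abs_le.mp (hD i hi)
    have hDe : e t ^ D = Complex.exp (2 * Real.pi * Complex.I * D * t) := by
      have := hpow D (by positivity) t
      simpa using this
    rw [eval_add, eval_mul, eval_mul, eval_pow, eval_pow, eval_C, eval_C, eval_X,
      hpow _ (by linarith), hpow _ (by linarith), hDe, map_mul, ← Complex.exp_conj, mul_add,
      mul_left_comm, ← Complex.exp_add, mul_left_comm, ← Complex.exp_add]
    congr 3
    · push_cast; ring
    · simp only [map_mul, Complex.conj_ofReal, Complex.conj_I, map_ofNat, map_intCast]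
      push_cast; ring
  have hdeg : P.natDegree ≤ 2 * D := by
    refine natDegree_sum_le_of_forall_le _ _ fun i hi => ?_
    have := abs_le.mp (hD i hi)
    refine (natDegree_add_le _ _).trans (max_le ?_ ?_)
    · exact (natDegree_C_mul_X_pow_le _ _).trans (by omega)
    · exact (natDegree_C_mul_X_pow_le _ _).trans (by omega)
  by_cases hP0 : P = 0
  · left
    intro t
    have h := hP t
    rw [hP0, eval_zero, eq_comm, mul_eq_zero] at h
    rcases h with h | h
    · exact absurd h (pow_ne_zero _ (he t))
    · simpa using h
  · right
    have hinj : Set.InjOn e (Set.Ioc 0 1) := by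
      intro x hx y hy hxy
      obtain ⟨m, hm⟩ := Complex.exp_eq_exp_iff_exists_int.mp hxy
      have hpi : (2 * Real.pi * Complex.I : ℂ) ≠ 0 := Complex.two_pi_I_ne_zero
      have h1 : (x : ℂ) = y + m := by
        apply mul_left_cancel₀ hpi
        rw [hm]; ring
      have h2 : x = y + m := by exact_mod_cast h1
      have h3 : (m : ℝ) < 1 := by linarith [hx.2, hy.1]
      have h4 : (-1 : ℝ) < m := by linarith [hx.1, hy.2]
      have h5 : m < 1 := by exact_mod_cast h3
      have h6 : -1 < m := by exact_mod_cast h4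
      have : m = 0 := by omega
      simpa [this] using h2
    have hmaps : Set.MapsTo e {t | t ∈ Set.Ioc (0 : ℝ) 1 ∧ (trigSum s a n t).re = 0}
        P.roots.toFinset := by
      intro t ht
      have : P.eval (e t) = 0 := by rw [hP, ht.2]; simp
      simpa [hP0] using this
    have hinj' : Set.InjOn e {t | t ∈ Set.Ioc (0 : ℝ) 1 ∧ (trigSum s a n t).re = 0} :=
      hinj.mono fun t ht => ht.1
    have hfin := Set.Finite.of_injOn hmaps hinj' (Finset.finite_toSet _)
    refine ⟨hfin.toFinset, ?_, fun t ht h0 => by simpa using ⟨ht, h0⟩⟩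
    refine (Finset.card_le_card_of_injOn e (by simpa using hmaps) (by simpa using hinj')).trans ?_
    exact (Multiset.toFinset_card_le _).trans ((card_roots' P).trans hdeg)

end trigSum

/-- If the derivative of `u` has at most `Z.card` zeros in `(0, 1]`, the part of the sublevel set
`|u| ≤ y` on which `|u'| ≥ c` has measure at most `(Z.card + 1) * 2 * y / c`. -/
theorem mul_volume_sublevel_le {u u' : ℝ → ℝ} (hu : ∀ t, HasDerivAt u (u' t) t)
    (hu' : Continuous u') (Z : Finset ℝ) (hZ : ∀ t ∈ Set.Ioc (0 : ℝ) 1, u' t = 0 → t ∈ Z)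
    (c y : ℝ) :
    ENNReal.ofReal c * volume {t | t ∈ Set.Ioc (0 : ℝ) 1 ∧ |u t| ≤ y ∧ c ≤ |u' t|} ≤
      (Z.card + 1 : ℕ) * ENNReal.ofReal (2 * y) := by
  classical
  have hucont : Continuous u := continuous_iff_continuousAt.mpr fun t => (hu t).continuousAt
  -- `N` cuts the period at the zeros of `u'`: two points with equal `N` have no point of `Z`
  -- between them, so `u` is injective there by Rolle.
  let N : ℝ → ℕ := fun t => (Z.filter (· < t)).card
  have hNmono : Monotone N := fun x y hxy =>
    Finset.card_le_card fun z hz => by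
      simp only [Finset.mem_filter] at hz ⊢
      exact ⟨hz.1, hz.2.trans_le hxy⟩
  let S : Set ℝ := {t | t ∈ Set.Ioc (0 : ℝ) 1 ∧ |u t| ≤ y ∧ c ≤ |u' t|}
  let T : ℕ → Set ℝ := fun j => S ∩ N ⁻¹' {j}
  have hSm : MeasurableSet S := by
    refine measurableSet_Ioc.inter (MeasurableSet.inter ?_ ?_)
    · exact (isClosed_le hucont.abs continuous_const).measurableSet
    · exact (isClosed_le continuous_const hu'.abs).measurableSet
  have hTm : ∀ j, MeasurableSet (T j) := fun j =>
    hSm.inter (hNmono.measurable (measurableSet_singleton j))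
  have hlt : ∀ j, ∀ x ∈ T j, ∀ z ∈ T j, x < z → u x ≠ u z := by
    intro j x hx z hz hxz heq
    obtain ⟨w, hw, hw0⟩ := exists_hasDerivAt_eq_zero hxz hucont.continuousOn heq
      fun t _ => hu t
    have hwZ : w ∈ Z := hZ w ⟨hx.1.1.1.trans hw.1, hw.2.le.trans hz.1.1.2⟩ hw0
    have hxN : N x = j := hx.2
    have hzN : N z = j := hz.2
    have : N x < N z := by
      refine Finset.card_lt_card ⟨fun t ht => ?_, fun h => ?_⟩
      · simp only [Finset.mem_filter] at ht ⊢
        exact ⟨ht.1, ht.2.trans hxz⟩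
      · have := h (Finset.mem_filter.mpr ⟨hwZ, hw.2⟩)
        exact absurd (Finset.mem_filter.mp this).2 (not_lt.mpr hw.1.le)
    omega
  have hinj : ∀ j, Set.InjOn u (T j) := by
    intro j x hx z hz heq
    rcases lt_trichotomy x z with h | h | h
    · exact absurd heq (hlt j x hx z hz h)
    · exact h
    · exact absurd heq.symm (hlt j z hz x hx h)
  -- By injectivity, the integral of `|u'|` over a piece is the measure of its image, which lies in
  -- `[-y, y]`.
  have hT : ∀ j, ENNReal.ofReal c * volume (T j) ≤ ENNReal.ofReal (2 * y) := by
    intro j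
    calc ENNReal.ofReal c * volume (T j) = ∫⁻ _ in T j, ENNReal.ofReal c := by
          rw [setLIntegral_const]
      _ ≤ ∫⁻ t in T j, ENNReal.ofReal |u' t| :=
          setLIntegral_mono' (hTm j) fun t ht => ENNReal.ofReal_le_ofReal ht.1.2.2
      _ = volume (u '' T j) := by
          have := lintegral_image_eq_lintegral_abs_deriv_mul (hTm j)
            (fun t _ => (hu t).hasDerivWithinAt) (hinj j) 1
          simpa using this.symm
      _ ≤ volume (Set.Icc (-y) y) := by
          refine measure_mono ?_
          rintro _ ⟨t, ht, rfl⟩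
          exact abs_le.mp ht.1.2.1
      _ = ENNReal.ofReal (2 * y) := by rw [Real.volume_Icc]; congr 1; ring
  have hcov : S ⊆ ⋃ j ∈ Finset.range (Z.card + 1), T j := by
    intro t ht
    simp only [Set.mem_iUnion, Finset.mem_range]
    exact ⟨N t, Nat.lt_succ_of_le (Finset.card_filter_le _ _), ht, rfl⟩
  calc ENNReal.ofReal c * volume S
      ≤ ENNReal.ofReal c * ∑ j ∈ Finset.range (Z.card + 1), volume (T j) :=
        mul_le_mul_right ((measure_mono hcov).trans (measure_biUnion_finset_le _ _)) _
    _ ≤ ∑ j ∈ Finset.range (Z.card + 1), ENNReal.ofReal (2 * y) := by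
        rw [Finset.mul_sum]; exact Finset.sum_le_sum fun j _ => hT j
    _ = _ := by simp

namespace trigSum

variable {ι : Type*} (s : Finset ι) (a : ι → ℂ) (n : ι → ℤ)

theorem mul_volume_re_sublevel_le (D : ℕ) (hD : ∀ i ∈ s, |n i| ≤ D) {c y : ℝ} (hc : 0 < c) :
    ENNReal.ofReal c * volume {t | t ∈ Set.Ioc (0 : ℝ) 1 ∧ |(trigSum s a n t).re| ≤ y ∧
        c ≤ |(trigSum s (fun i => 2 * Real.pi * Complex.I * n i * a i) n t).re|} ≤
      (2 * D + 1 : ℕ) * ENNReal.ofReal (2 * y) := by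
  rcases re_zeros s (fun i => 2 * Real.pi * Complex.I * n i * a i) n D hD with h | ⟨Z, hZ, h⟩
  · simp [h, hc.not_ge]
  · refine (mul_volume_sublevel_le (hasDerivAt_re s a n)
      (Complex.continuous_re.comp (continuous _ _ _)) Z h c y).trans ?_
    gcongr

/-- The number of pieces, at most `4 * D + 1`, grows like the degree; asking the derivative to be at
least `D * δ` compensates, and the bound no longer depends on `D`. -/
theorem volume_re_sublevel_le (D : ℕ) (hD0 : 0 < D) (hD : ∀ i ∈ s, |n i| ≤ (2 * D : ℕ)) {δ y : ℝ}
    (hδ : 0 < δ) (hy : 0 ≤ y) :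
    volume {t | t ∈ Set.Ioc (0 : ℝ) 1 ∧ |(trigSum s a n t).re| ≤ y ∧
        D * δ ≤ |(trigSum s (fun i => 2 * Real.pi * Complex.I * n i * a i) n t).re|} ≤
      ENNReal.ofReal (10 * (y / δ)) := by
  have hDr : (1 : ℝ) ≤ D := by exact_mod_cast hD0
  have hc : 0 < D * δ := by positivity
  have hc' : ENNReal.ofReal (D * δ) ≠ 0 := (ENNReal.ofReal_pos.mpr hc).ne'
  have h := mul_volume_re_sublevel_le s a n (2 * D) hD (y := y) hc
  rw [mul_comm, ← ENNReal.le_div_iff_mul_le (Or.inl hc')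
    (Or.inl ENNReal.ofReal_ne_top)] at h
  refine h.trans ?_
  rw [← ENNReal.ofReal_natCast, ← ENNReal.ofReal_mul (by positivity),
    ← ENNReal.ofReal_div_of_pos hc]
  refine ENNReal.ofReal_le_ofReal ?_
  rw [div_le_iff₀ hc]
  have : 10 * (y / δ) * (D * δ) = 10 * y * D := by field_simp
  rw [this]
  push_cast
  nlinarith

/-- A sublevel set estimate for exponential sums, uniform among those with a given number
of terms. -/
theorem exists_volume_sublevel_le (m : ℕ) :
    ∃ C α : ℝ, 0 ≤ C ∧ 0 < α ∧ α ≤ 1 ∧ ∀ (s : Finset ι) (a : ι → ℂ) (n : ι → ℤ), s.card = m + 1 →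
      Set.InjOn n s → (∃ i ∈ s, 1 ≤ ‖a i‖) → ∀ y : ℝ, 0 < y → y ≤ 1 →
      volume {t | t ∈ Set.Ioc (0 : ℝ) 1 ∧ ‖trigSum s a n t‖ ≤ y} ≤ ENNReal.ofReal (C * y ^ α) := by
  classical
  induction m with
  | zero =>
    refine ⟨1, 1, zero_le_one, zero_lt_one, le_rfl, fun s a n hs _ ha y hy0 hy1 => ?_⟩
    obtain ⟨i, rfl⟩ := Finset.card_eq_one.mp hs
    obtain ⟨j, hj, haj⟩ := ha
    obtain rfl := Finset.mem_singleton.mp hj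
    have hnorm : ∀ t, ‖trigSum {j} a n t‖ = ‖a j‖ := by
      intro t
      have : (2 * Real.pi * Complex.I * n j * t : ℂ) = ((2 * Real.pi * n j * t : ℝ) : ℂ) *
          Complex.I := by push_cast; ring
      rw [trigSum, Finset.sum_singleton, norm_mul, this, Complex.norm_exp_ofReal_mul_I, mul_one]
    simp only [hnorm]
    by_cases h : ‖a j‖ ≤ y
    · have hy : y = 1 := by linarith
      refine (measure_mono (fun t ht => ht.1 : _ ⊆ Set.Ioc (0 : ℝ) 1)).trans ?_
      simp [hy]
    · simp [h]
  | succ m ih =>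
    obtain ⟨C, α, hC, hα, hα1, H⟩ := ih
    -- With `δ = √y`, the three bad sets below cost `C * δ ^ α`, `10 * δ` and `10 * δ`; `α ≤ 1`
    -- gives `δ ≤ y ^ (α / 2)`.
    refine ⟨C + 20, α / 2, by positivity, by positivity, by linarith,
      fun s a n hs hn ha y hy0 hy1 => ?_⟩
    obtain ⟨i₀, hi₀, ha₀⟩ := ha
    -- The frequency `n l` farthest from `n i₀` is shifted to zero. Differentiating then kills the
    -- term `l`, and after division by `D` the coefficient at `i₀` keeps its modulus, at least 1.
    obtain ⟨l, hl, hmax⟩ := s.exists_max_image (fun i => |n i - n i₀|) ⟨i₀, hi₀⟩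
    have hne : n l ≠ n i₀ := by
      obtain ⟨j, hj, hji⟩ := Finset.exists_mem_ne (by omega : 1 < s.card) i₀
      have h1 := hmax j hj
      have h2 : n j ≠ n i₀ := fun h => hji (hn hj hi₀ h)
      intro h
      simp only [h, sub_self, abs_zero, abs_nonpos_iff, sub_eq_zero] at h1
      exact h2 h1
    obtain ⟨D, hDdef⟩ : ∃ D : ℕ, (D : ℤ) = |n l - n i₀| := ⟨_, Int.natCast_natAbs _⟩
    have hD0 : 0 < D := by
      have : 0 < |n l - n i₀| := abs_pos.mpr (sub_ne_zero.mpr hne)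
      omega
    have hDr : (0 : ℝ) < D := by exact_mod_cast hD0
    let n' : ι → ℤ := fun i => n i - n l
    have hn'D : ∀ i ∈ s, |n' i| ≤ (2 * D : ℕ) := by
      intro i hi
      have h1 := hmax i hi
      simp only [← hDdef] at h1
      rw [abs_le] at h1
      have h2 := abs_le.mp hDdef.ge
      rw [abs_le]
      push_cast
      simp only [n']
      constructor <;> linarith [h1.1, h1.2, h2.1, h2.2]
    let b : ι → ℂ := fun i => n' i / D * a i
    let δ := Real.sqrt y
    have hδ : 0 < δ := Real.sqrt_pos.mpr hy0
    have hyδ : y / δ = δ := Real.div_sqrt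
    have hδ1 : δ ≤ 1 := Real.sqrt_le_one.mpr hy1
    have hg : ∀ t, trigSum s (fun i => 2 * Real.pi * Complex.I * n' i * a i) n' t =
        2 * Real.pi * Complex.I * D * trigSum (s.erase l) b n' t := by
      intro t
      have hDc : (D : ℂ) ≠ 0 := by exact_mod_cast hD0.ne'
      rw [trigSum, ← Finset.add_sum_erase s _ hl, trigSum, Finset.mul_sum]
      simp only [n', b, sub_self, Int.cast_zero, mul_zero, zero_mul, zero_add]
      refine Finset.sum_congr rfl fun i _ => ?_
      field_simp
    have hE1 := H (s.erase l) b n' (by rw [Finset.card_erase_of_mem hl]; omega)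
      (fun i hi j hj hij => hn (Finset.mem_of_mem_erase hi) (Finset.mem_of_mem_erase hj)
        (by simpa [n'] using hij))
      ⟨i₀, Finset.mem_erase.mpr ⟨fun h => hne (h ▸ rfl), hi₀⟩, by
        have : ‖(n' i₀ : ℂ) / D‖ = 1 := by
          rw [norm_div, Complex.norm_intCast, Complex.norm_natCast]
          have : |((n' i₀ : ℤ) : ℝ)| = D := by
            rw [← Int.cast_abs]
            simp only [n']
            rw [abs_sub_comm, ← hDdef]; simp
          rw [this, div_self hDr.ne']
        simp only [b]
        rwa [norm_mul, this, one_mul]⟩ δ hδ hδ1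
    have hE2 := volume_re_sublevel_le s a n' D hD0 hn'D hδ hy0.le
    have hE3 := volume_re_sublevel_le s (fun i => -Complex.I * a i) n' D hD0 hn'D hδ hy0.le
    rw [hyδ] at hE2 hE3
    have hE := (measure_union_le _ _).trans
      (add_le_add hE1 ((measure_union_le _ _).trans (add_le_add hE2 hE3)))
    refine (measure_mono ?_).trans (hE.trans ?_)
    · intro t ⟨ht, hty⟩
      rw [← norm_shift s a n (n l)] at hty
      by_cases h1 : ‖trigSum (s.erase l) b n' t‖ ≤ δ
      · exact Or.inl ⟨ht, h1⟩
      · right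
        have h2 : 2 * (D * δ) ≤
            ‖trigSum s (fun i => 2 * Real.pi * Complex.I * n' i * a i) n' t‖ := by
          rw [hg, norm_mul, norm_mul, norm_mul, norm_mul, Complex.norm_I, Complex.norm_natCast,
            Complex.norm_ofNat, Complex.norm_real, Real.norm_of_nonneg Real.pi_pos.le]
          have := Real.pi_gt_three
          push Not at h1
          calc 2 * (D * δ) = 2 * 1 * 1 * D * δ := by ring
            _ ≤ _ := by gcongr; linarith
        have h3 := Complex.norm_le_abs_re_add_abs_im
          (trigSum s (fun i => 2 * Real.pi * Complex.I * n' i * a i) n' t)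
        rcases le_total (D * δ)
          |(trigSum s (fun i => 2 * Real.pi * Complex.I * n' i * a i) n' t).re| with h | h
        · exact Or.inl ⟨ht, (Complex.abs_re_le_norm _).trans hty, h⟩
        · refine Or.inr ⟨ht, ?_, ?_⟩
          -- The imaginary part is treated as the real part of `-I` times the sum.
          · rw [const_mul]
            refine (Complex.abs_re_le_norm _).trans ?_
            simpa using hty
          · have : (fun i => 2 * Real.pi * Complex.I * n' i * (-Complex.I * a i)) =
                fun i => -Complex.I * (2 * Real.pi * Complex.I * n' i * a i) := by
              funext i; ring
            rw [this, const_mul]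
            have : ∀ z : ℂ, (-Complex.I * z).re = z.im := by intro z; simp
            rw [this]
            linarith
    · rw [← ENNReal.ofReal_add (by positivity) (by positivity),
        ← ENNReal.ofReal_add (by positivity) (by positivity)]
      refine ENNReal.ofReal_le_ofReal ?_
      have h1 : δ ^ α = y ^ (α / 2) := by
        simp only [δ]
        rw [Real.sqrt_eq_rpow, ← Real.rpow_mul hy0.le]; congr 1; ring
      have h2 : δ ≤ y ^ (α / 2) := by
        simp only [δ]
        rw [Real.sqrt_eq_rpow]
        exact Real.rpow_le_rpow_of_exponent_ge hy0 hy1 (by linarith)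
      rw [h1]
      linarith

end trigSum

open Filter Topology

namespace LehmerConstant

/-! ### Restriction of characters along homomorphisms -/

section Pullback

variable {G H : Type*} [AddCommGroup G] [TopologicalSpace G] [AddCommGroup H] [TopologicalSpace H]

/-- The pullback of characters along a continuous homomorphism. -/
noncomputable def dualMap (φ : G →ₜ+ H) : Dual H → Dual G :=
  PontryaginDual.map
    { toMonoidHom := AddMonoidHom.toMultiplicative φ.toAddMonoidHom
      continuous_toFun := φ.continuous_toFun }

theorem dualMap_apply (φ : G →ₜ+ H) (χ : Dual H) (x : G) :
    dualMap φ χ (Multiplicative.ofAdd x) = χ (Multiplicative.ofAdd (φ x)) := rfl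

/-- The pullback of an integral combination of characters along a continuous homomorphism. -/
noncomputable def pullback (φ : G →ₜ+ H) (f : IntCharRing H) : IntCharRing G :=
  MonoidAlgebra.mapDomain (dualMap φ) f

theorem evalAt_eq_sum (f : IntCharRing G) (x : G) :
    evalAt f x = ∑ χ ∈ f.coeff.support, (f.coeff χ : ℂ) * (χ (Multiplicative.ofAdd x) : ℂ) := rfl

theorem evalAt_pullback (φ : G →ₜ+ H) (f : IntCharRing H) (x : G) :
    evalAt (pullback φ f) x = evalAt f (φ x) := by
  unfold evalAt pullback MonoidAlgebra.mapDomain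
  exact Finsupp.sum_mapDomain_index (by simp) (by intros; push_cast; ring)

theorem char_add (χ : Dual G) (x y : G) :
    (χ (Multiplicative.ofAdd (x + y)) : ℂ) =
      χ (Multiplicative.ofAdd x) * χ (Multiplicative.ofAdd y) := by
  rw [ofAdd_add, map_mul, Circle.coe_mul]

theorem continuous_char (χ : Dual G) :
    Continuous fun x : G => (χ (Multiplicative.ofAdd x) : ℂ) :=
  continuous_subtype_val.comp ((map_continuous χ).comp continuous_ofAdd)

theorem continuous_evalAt (f : IntCharRing G) : Continuous (evalAt f) := by
  have : evalAt f = fun x => ∑ χ ∈ f.coeff.support,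
    (f.coeff χ : ℂ) * (χ (Multiplicative.ofAdd x) : ℂ) := funext (evalAt_eq_sum f)
  rw [this]
  exact continuous_finsetSum _ fun χ _ => continuous_const.mul (continuous_char χ)

end Pullback

/-! ### Haar measure and the characters of the circle -/

section Haar

variable (G : Type*) [AddCommGroup G] [TopologicalSpace G] [IsTopologicalAddGroup G]
    [CompactSpace G] [MeasurableSpace G] [BorelSpace G]

instance : (normalizedHaar G).IsAddHaarMeasure :=
  inferInstanceAs (Measure.addHaarMeasure ⊤).IsAddHaarMeasure

instance : IsProbabilityMeasure (normalizedHaar G) :=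
  ⟨Measure.addHaarMeasure_self⟩

variable {G}

/-- Translating by `x` multiplies the integral by `F x ≠ 1` and leaves it unchanged. -/
theorem integral_eq_zero_of_multiplicative {F : G → ℂ} (hF : ∀ x y, F (x + y) = F x * F y)
    (h : ∃ x, F x ≠ 1) : ∫ x, F x ∂normalizedHaar G = 0 := by
  obtain ⟨x, hx⟩ := h
  have h1 := integral_add_left_eq_self (μ := normalizedHaar G) F x
  simp_rw [hF, integral_const_mul] at h1
  have h2 : (F x - 1) * ∫ y, F y ∂normalizedHaar G = 0 := by rw [sub_mul, h1]; ring
  exact (mul_eq_zero.mp h2).resolve_left (sub_ne_zero.mpr hx)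

end Haar

theorem normalizedHaar_unitAddCircle : normalizedHaar UnitAddCircle = volume := by
  have : (volume : Measure UnitAddCircle) =
    ENNReal.ofReal 1 • (Measure.addHaarMeasure ⊤ : Measure UnitAddCircle) := rfl
  rw [this, ENNReal.ofReal_one, one_smul]
  rfl

instance : IsProbabilityMeasure (volume : Measure UnitAddCircle) := ⟨by simp⟩

theorem normalizedHaar_torus (k : ℕ) : normalizedHaar (Fin k → UnitAddCircle) = volume :=
  Measure.isAddHaarMeasure_eq_of_isProbabilityMeasure _ _

theorem fourier_add_apply (n : ℤ) (x y : UnitAddCircle) :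
    fourier n (x + y) = fourier n x * fourier n y := by
  simp [fourier_apply, smul_add, AddCircle.toCircle_add]

theorem integral_fourier {n : ℤ} (hn : n ≠ 0) :
    ∫ x, fourier n x ∂normalizedHaar UnitAddCircle = 0 :=
  integral_eq_zero_of_add_right_eq_neg (fourier_add_half_inv_index hn zero_lt_one)

/-- Every continuous character of the circle is a Fourier monomial. -/
theorem exists_char_eq_fourier (χ : Dual UnitAddCircle) :
    ∃ n : ℤ, ∀ x : UnitAddCircle, (χ (Multiplicative.ofAdd x) : ℂ) = fourier n x := by
  by_contra! hcon
  obtain ⟨F, hFχ⟩ : ∃ F : C(UnitAddCircle, ℂ), ∀ x, F x = χ (Multiplicative.ofAdd x) :=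
    ⟨⟨_, continuous_char χ⟩, fun _ => rfl⟩
  have hFadd : ∀ x y, F (x + y) = F x * F y := fun x y => by simp only [hFχ, char_add]
  -- A character different from all monomials is orthogonal to each of them, so its Fourier series
  -- sums to 0, although its value at 0 is 1.
  have hF : ∀ n, fourierCoeff F n = 0 := by
    intro n
    have hint : fourierCoeff F n =
      ∫ x, fourier (-n) x * F x ∂normalizedHaar UnitAddCircle := rfl
    rw [hint]
    refine integral_eq_zero_of_multiplicative (fun x y => ?_) ?_
    · rw [fourier_add_apply, hFadd, mul_mul_mul_comm]
    · obtain ⟨x, hx⟩ := hcon n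
      refine ⟨x, fun h => hx ?_⟩
      have h1 : fourier n x * fourier (-n) x = 1 := by
        rw [← fourier_add, add_neg_cancel, fourier_zero]
      rw [← hFχ, ← one_mul (F x), ← h1, mul_assoc, h, mul_one]
  have h1 : HasSum (fun n => fourierCoeff F n • fourier n) F :=
    hasSum_fourier_series_of_summable ((summable_congr hF).mpr summable_zero)
  have h2 : HasSum (fun n => fourierCoeff F n • fourier n) (0 : C(UnitAddCircle, ℂ)) := by
    have : (fun n => fourierCoeff F n • (fourier n : C(UnitAddCircle, ℂ))) = fun _ => 0 :=
      funext fun n => ContinuousMap.ext fun x => by simp [hF n]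
    rw [this]
    exact hasSum_zero
  have h3 : F 0 = 1 := by rw [hFχ, ofAdd_zero, map_one, Circle.coe_one]
  rw [h1.unique h2] at h3
  exact zero_ne_one h3

/-! ### Equidistribution along curves in the torus -/

section Curve

variable {k : ℕ}

/-- The one-parameter subgroup `t ↦ (t, N t, N² t, …)` of the torus. -/
noncomputable def curve (k N : ℕ) : UnitAddCircle →ₜ+ (Fin k → UnitAddCircle) where
  toFun t i := (N ^ (i : ℕ)) • t
  map_zero' := by ext; simp
  map_add' x y := by ext; simp
  continuous_toFun := continuous_pi fun _ => continuous_nsmul _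

theorem fourier_sum {ι : Type*} (s : Finset ι) (a : ι → ℤ) (t : UnitAddCircle) :
    fourier (∑ i ∈ s, a i) t = ∏ i ∈ s, fourier (a i) t := by
  classical
  induction s using Finset.induction_on with
  | empty => simp
  | insert i s hi ih => rw [Finset.sum_insert hi, Finset.prod_insert hi, fourier_add, ih]

theorem mFourier_curve (m : Fin k → ℤ) (N : ℕ) (t : UnitAddCircle) :
    UnitAddTorus.mFourier m (curve k N t) = fourier (∑ i, m i * (N : ℤ) ^ (i : ℕ)) t := by
  rw [fourier_sum]
  change ∏ i, fourier (m i) (curve k N t i) = _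
  refine Finset.prod_congr rfl fun i _ => ?_
  have : curve k N t i = (N ^ (i : ℕ)) • t := rfl
  rw [this, fourier_apply, fourier_apply, mul_smul, ← Nat.cast_pow, natCast_zsmul]

/-- The sum is a nonzero polynomial evaluated at `N`, so only finitely many `N` are roots. -/
theorem eventually_sum_ne_zero {m : Fin k → ℤ} (hm : m ≠ 0) :
    ∀ᶠ N : ℕ in atTop, ∑ i, m i * (N : ℤ) ^ (i : ℕ) ≠ 0 := by
  open Polynomial in
  let P : ℤ[X] := ∑ i : Fin k, C (m i) * X ^ (i : ℕ)
  have hP : P ≠ 0 := by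
    obtain ⟨j, hj⟩ := Function.ne_iff.mp hm
    intro h
    have h1 : P.coeff j = m j := by
      simp [P, Polynomial.finsetSum_coeff, Polynomial.coeff_X_pow, Fin.val_inj]
    rw [h, Polynomial.coeff_zero] at h1
    exact hj h1.symm
  have hfin : {N : ℕ | (N : ℤ) ∈ {x | P.IsRoot x}}.Finite :=
    (Polynomial.finite_setOfPred_isRoot hP).preimage Nat.cast_injective.injOn
  rw [← Nat.cofinite_eq_atTop]
  filter_upwards [hfin.eventually_cofinite_notMem] with N hN h
  refine hN ?_
  simpa [P, Polynomial.eval_finsetSum, Polynomial.IsRoot] using h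

theorem integral_mFourier {m : Fin k → ℤ} (hm : m ≠ 0) :
    ∫ x, UnitAddTorus.mFourier m x ∂normalizedHaar (Fin k → UnitAddCircle) = 0 := by
  refine integral_eq_zero_of_multiplicative (fun x y => ?_) ?_
  · have : ∀ z, UnitAddTorus.mFourier m z = ∏ i, fourier (m i) (z i) := fun _ => rfl
    simp only [this, ← Finset.prod_mul_distrib, Pi.add_apply, fourier_add_apply]
  · obtain ⟨N, hN⟩ := (eventually_sum_ne_zero hm).exists
    -- Half a period of the restricted monomial, where its value is `-1`.
    refine ⟨curve k N (0 + ((1 / 2 / (∑ i, m i * (N : ℤ) ^ (i : ℕ) : ℤ) : ℝ) : UnitAddCircle)), ?_⟩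
    rw [mFourier_curve, fourier_add_half_inv_index hN zero_lt_one, fourier_eval_zero]
    norm_num

/-- The images of the normalized Haar measure under the curves `t ↦ (t, N t, N² t, …)` converge
weakly to the normalized Haar measure of the torus. -/
theorem tendsto_integral_curve (g : C(Fin k → UnitAddCircle, ℂ)) :
    Tendsto (fun N : ℕ => ∫ t, g (curve k N t) ∂normalizedHaar UnitAddCircle) atTop
      (𝓝 (∫ x, g x ∂normalizedHaar (Fin k → UnitAddCircle))) := by
  have hc : ∀ (h : C(Fin k → UnitAddCircle, ℂ)) N, Continuous fun t => h (curve k N t) :=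
    fun h N => h.continuous.comp (curve k N).continuous_toFun
  have hi : ∀ (h : C(Fin k → UnitAddCircle, ℂ)) N,
      Integrable (fun t => h (curve k N t)) (normalizedHaar UnitAddCircle) :=
    fun h N => (hc h N).integrable_of_hasCompactSupport (.of_compactSpace _)
  have hi' : ∀ h : C(Fin k → UnitAddCircle, ℂ),
      Integrable h (normalizedHaar (Fin k → UnitAddCircle)) :=
    fun h => h.continuous.integrable_of_hasCompactSupport (.of_compactSpace _)
  have hspan : ∀ h ∈ Submodule.span ℂ (Set.range (UnitAddTorus.mFourier (d := Fin k))),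
      Tendsto (fun N : ℕ => ∫ t, h (curve k N t) ∂normalizedHaar UnitAddCircle) atTop
        (𝓝 (∫ x, h x ∂normalizedHaar (Fin k → UnitAddCircle))) := by
    intro h hh
    induction hh using Submodule.span_induction with
    | mem h hh =>
      obtain ⟨m, rfl⟩ := hh
      by_cases hm : m = 0
      · subst hm
        simp [UnitAddTorus.mFourier_zero]
      · rw [integral_mFourier hm]
        refine tendsto_const_nhds.congr' ?_
        filter_upwards [eventually_sum_ne_zero hm] with N hN
        simp only [mFourier_curve]
        exact (integral_fourier hN).symm
    | zero => simp
    | add x y _ _ hx hy =>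
      simp only [ContinuousMap.add_apply]
      rw [integral_add (hi' x) (hi' y)]
      simp only [integral_add (hi x _) (hi y _)]
      exact hx.add hy
    | smul c x _ hx =>
      simp only [ContinuousMap.smul_apply, integral_smul]
      exact hx.const_smul c
  have hg : g ∈ closure
      (Submodule.span ℂ (Set.range (UnitAddTorus.mFourier (d := Fin k))) : Set _) := by
    rw [← Submodule.topologicalClosure_coe, UnitAddTorus.span_mFourier_closure_eq_top]
    trivial
  rw [Metric.tendsto_atTop]
  intro ε hε
  obtain ⟨h, hh, hgh⟩ := Metric.mem_closure_iff.mp hg (ε / 3) (by positivity)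
  obtain ⟨N₀, hN₀⟩ := Metric.tendsto_atTop.mp (hspan h hh) (ε / 3) (by positivity)
  refine ⟨N₀, fun N hN => ?_⟩
  have hpt : ∀ x, ‖g x - h x‖ ≤ ε / 3 := fun x => by
    rw [← dist_eq_norm]; exact (ContinuousMap.dist_apply_le_dist x).trans hgh.le
  have h1 : dist (∫ t, g (curve k N t) ∂normalizedHaar UnitAddCircle)
      (∫ t, h (curve k N t) ∂normalizedHaar UnitAddCircle) ≤ ε / 3 := by
    rw [dist_eq_norm, ← integral_sub (hi g N) (hi h N)]
    refine (norm_integral_le_of_norm_le_const (.of_forall fun t => hpt _)).trans ?_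
    simp
  have h2 : dist (∫ x, h x ∂normalizedHaar (Fin k → UnitAddCircle))
      (∫ x, g x ∂normalizedHaar (Fin k → UnitAddCircle)) ≤ ε / 3 := by
    rw [dist_comm, dist_eq_norm, ← integral_sub (hi' g) (hi' h)]
    refine (norm_integral_le_of_norm_le_const (.of_forall fun t => hpt _)).trans ?_
    simp
  have h3 := hN₀ N hN
  have h4 := dist_triangle4 (∫ t, g (curve k N t) ∂normalizedHaar UnitAddCircle)
    (∫ t, h (curve k N t) ∂normalizedHaar UnitAddCircle)
    (∫ x, h x ∂normalizedHaar (Fin k → UnitAddCircle))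
    (∫ x, g x ∂normalizedHaar (Fin k → UnitAddCircle))
  linarith

theorem tendsto_lintegral_curve {g : (Fin k → UnitAddCircle) → ENNReal} (hg : Continuous g)
    (hfin : ∀ x, g x ≠ ⊤) :
    Tendsto (fun N : ℕ => ∫⁻ t, g (curve k N t) ∂normalizedHaar UnitAddCircle) atTop
      (𝓝 (∫⁻ x, g x ∂normalizedHaar (Fin k → UnitAddCircle))) := by
  let r : (Fin k → UnitAddCircle) → ℝ := fun x => (g x).toReal
  have hr : Continuous r := ENNReal.continuousOn_toReal.comp_continuous hg hfin
  have hr0 : ∀ x, 0 ≤ r x := fun x => ENNReal.toReal_nonneg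
  have hgr : ∀ x, g x = ENNReal.ofReal (r x) := fun x => (ENNReal.ofReal_toReal (hfin x)).symm
  let F : C(Fin k → UnitAddCircle, ℂ) := ⟨fun x => (r x : ℂ), Complex.continuous_ofReal.comp hr⟩
  have h1 : Tendsto (fun N : ℕ => ∫ t, r (curve k N t) ∂normalizedHaar UnitAddCircle) atTop
      (𝓝 (∫ x, r x ∂normalizedHaar (Fin k → UnitAddCircle))) := by
    have h := (Complex.continuous_re.tendsto _).comp (tendsto_integral_curve F)
    simp only [F, ContinuousMap.coe_mk, integral_complex_ofReal, Complex.ofReal_re] at h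
    exact h.congr fun N => by simp
  have h2 : ∀ N : ℕ, ∫⁻ t, g (curve k N t) ∂normalizedHaar UnitAddCircle =
      ENNReal.ofReal (∫ t, r (curve k N t) ∂normalizedHaar UnitAddCircle) := by
    intro N
    have hrc : Continuous fun t => r (curve k N t) := hr.comp (curve k N).continuous_toFun
    rw [ofReal_integral_eq_lintegral_ofReal
      (hrc.integrable_of_hasCompactSupport (.of_compactSpace _))
      (.of_forall fun t => hr0 _)]
    simp only [hgr]
  have h3 : ∫⁻ x, g x ∂normalizedHaar (Fin k → UnitAddCircle) =
      ENNReal.ofReal (∫ x, r x ∂normalizedHaar (Fin k → UnitAddCircle)) := by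
    rw [ofReal_integral_eq_lintegral_ofReal
      (hr.integrable_of_hasCompactSupport (.of_compactSpace _)) (.of_forall hr0)]
    simp only [hgr]
  simp only [h2, h3]
  exact ENNReal.tendsto_ofReal h1

/-- If `χ ≠ ψ` agree on a curve, then `χ * ψ⁻¹` has integral 1 along it; by equidistribution these
integrals tend to 0. -/
theorem eventually_injOn_dualMap_curve (s : Finset (Dual (Fin k → UnitAddCircle))) :
    ∀ᶠ N : ℕ in atTop, Set.InjOn (dualMap (curve k N)) s := by
  have key : ∀ χ ∈ s, ∀ ψ ∈ s, ∀ᶠ N : ℕ in atTop,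
      dualMap (curve k N) χ = dualMap (curve k N) ψ → χ = ψ := by
    intro χ _ ψ _
    by_cases hne : χ = ψ
    · simp [hne]
    let F : C(Fin k → UnitAddCircle, ℂ) := ⟨_, continuous_char (χ * ψ⁻¹)⟩
    have hF : ∫ x, F x ∂normalizedHaar (Fin k → UnitAddCircle) = 0 := by
      refine integral_eq_zero_of_multiplicative (char_add (χ * ψ⁻¹)) ?_
      by_contra! hcon
      refine hne (mul_inv_eq_one.mp (PontryaginDual.ext fun x => ?_))
      exact Circle.ext (hcon x.toAdd)
    have h1 := tendsto_integral_curve F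
    rw [hF] at h1
    filter_upwards [h1.eventually_ne (zero_ne_one' ℂ)] with N hN heq
    refine absurd ?_ hN
    have : ∀ t, F (curve k N t) = 1 := by
      intro t
      have h2 : χ (Multiplicative.ofAdd (curve k N t)) = ψ (Multiplicative.ofAdd (curve k N t)) := by
        rw [← dualMap_apply, heq, dualMap_apply]
      have h3 : F (curve k N t) = ((χ (Multiplicative.ofAdd (curve k N t)) *
        (ψ (Multiplicative.ofAdd (curve k N t)))⁻¹ : Circle) : ℂ) := rfl
      rw [h3, h2, mul_inv_cancel, Circle.coe_one]
    simp [this]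
  filter_upwards [(eventually_all_finset s).mpr fun χ hχ =>
    (eventually_all_finset s).mpr (key χ hχ)] with N hN χ hχ ψ hψ h
  exact hN χ hχ ψ hψ h

end Curve

end LehmerConstant

/-! ### Positive and negative parts of the logarithm -/

namespace LehmerConstant

/-- The positive part of `log |z|`. -/
noncomputable def logPosPart (z : ℂ) : ENNReal := (ENNReal.log ‖z‖ₑ).toENNReal

/-- The negative part of `log |z|`, with value `∞` at `0`. -/
noncomputable def logNegPart (z : ℂ) : ENNReal := (-ENNReal.log ‖z‖ₑ).toENNReal

theorem continuous_logPosPart : Continuous logPosPart :=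
  EReal.continuous_toENNReal.comp (ENNReal.continuous_log.comp continuous_enorm)

theorem continuous_logNegPart : Continuous logNegPart :=
  EReal.continuous_toENNReal.comp (ENNReal.continuous_log.comp continuous_enorm).neg

theorem logPosPart_ne_top (z : ℂ) : logPosPart z ≠ ⊤ := by
  rw [logPosPart, Ne, EReal.toENNReal_eq_top_iff, ENNReal.log_eq_top_iff]
  exact enorm_ne_top

theorem norm_le_exp_neg_of_lt_logNegPart {z : ℂ} {n : ℕ} (h : n < logNegPart z) :
    ‖z‖ ≤ Real.exp (-n) := by
  by_contra! hz
  have hpos : 0 < ‖z‖ := (Real.exp_pos _).trans hz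
  have hlog : -Real.log ‖z‖ < n := by
    have := (Real.lt_log_iff_exp_lt hpos).mpr hz
    linarith
  refine absurd h (not_lt.mpr ?_)
  rw [logNegPart, ← ofReal_norm, ENNReal.log_ofReal_of_pos hpos, ← EReal.coe_neg,
    EReal.toENNReal_of_ne_top (EReal.coe_ne_top _), EReal.toReal_coe, ← ENNReal.ofReal_natCast]
  exact ENNReal.ofReal_le_ofReal hlog.le

/-- The excess of `g` over `A` is at most the number of integers from `A` on that lie below `g`.
Integrated, this bounds the tail by measures of level sets. -/
theorem le_min_add_tsum (g : ENNReal) (A : ℕ) :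
    g ≤ min g A + ∑' j : ℕ, if ((j + A : ℕ) : ENNReal) < g then 1 else 0 := by
  by_cases hg : g = ⊤
  · subst hg
    have : ∀ j : ℕ, ((j + A : ℕ) : ENNReal) < ⊤ := fun j => ENNReal.natCast_lt_top _
    simp only [this, if_true]
    rw [ENNReal.tsum_const_eq_top_of_ne_zero one_ne_zero]
    simp
  · lift g to NNReal using hg
    rcases le_total g A with h | h
    · rw [min_eq_left (by exact_mod_cast h)]
      exact le_self_add
    · rw [min_eq_right (by exact_mod_cast h)]
      have h1 : ((⌈g⌉₊ - A : ℕ) : ENNReal) ≤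
          ∑' j : ℕ, if ((j + A : ℕ) : ENNReal) < (g : ENNReal) then 1 else 0 := by
        calc ((⌈g⌉₊ - A : ℕ) : ENNReal)
            = ∑ j ∈ Finset.range (⌈g⌉₊ - A),
                if ((j + A : ℕ) : ENNReal) < (g : ENNReal) then 1 else 0 := by
              rw [Finset.sum_congr rfl (g := fun _ => (1 : ENNReal))]
              · simp
              · intro j hj
                rw [Finset.mem_range] at hj
                have h2 : ((j + A : ℕ) : NNReal) < g := Nat.lt_ceil.mp (by omega)
                exact if_pos (by exact_mod_cast h2)
          _ ≤ _ := ENNReal.sum_le_tsum _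
      calc (g : ENNReal) ≤ (⌈g⌉₊ : ℕ) := by exact_mod_cast Nat.le_ceil g
        _ ≤ ((A + (⌈g⌉₊ - A) : ℕ) : ENNReal) := by exact_mod_cast (by omega)
        _ ≤ _ := by
          rw [Nat.cast_add]
          gcongr

section Haar

variable {G : Type*} [AddCommGroup G] [TopologicalSpace G] [IsTopologicalAddGroup G]
    [CompactSpace G] [MeasurableSpace G] [BorelSpace G]

theorem logMahler_eq (f : IntCharRing G) :
    logMahler f = ((∫⁻ x, logPosPart (evalAt f x) ∂normalizedHaar G : ENNReal) : EReal) -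
      ((∫⁻ x, logNegPart (evalAt f x) ∂normalizedHaar G : ENNReal) : EReal) := rfl

theorem logMahler_zero : logMahler (0 : IntCharRing G) = ⊥ := by
  have h : ∀ x : G, evalAt (0 : IntCharRing G) x = 0 := fun x => by simp [evalAt]
  simp [logMahler_eq, h, logPosPart, logNegPart]

theorem logMahler_pullback_of_measurePreserving {H : Type*} [AddCommGroup H] [TopologicalSpace H]
    [IsTopologicalAddGroup H] [CompactSpace H] [MeasurableSpace H] [BorelSpace H]
    (φ : G →ₜ+ H) (hφ : MeasurePreserving φ (normalizedHaar G) (normalizedHaar H))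
    (f : IntCharRing H) : logMahler (pullback φ f) = logMahler f := by
  simp only [logMahler_eq, evalAt_pullback]
  rw [hφ.lintegral_comp (f := fun x => logPosPart (evalAt f x))
      (continuous_logPosPart.comp (continuous_evalAt f)).measurable,
    hφ.lintegral_comp (f := fun x => logNegPart (evalAt f x))
      (continuous_logNegPart.comp (continuous_evalAt f)).measurable]

end Haar

/-! ### Uniform integrability of the negative part -/

section Tail

variable {H : Type*} [AddCommGroup H] [TopologicalSpace H]

/-- A sublevel set estimate for the restrictions of an integral combination of characters to
one-parameter subgroups, uniform among those which separate the characters involved. -/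
theorem exists_measure_sublevel_le {f : IntCharRing H} (hf : f ≠ 0) :
    ∃ C α : ℝ, 0 ≤ C ∧ 0 < α ∧ ∀ φ : UnitAddCircle →ₜ+ H,
      Set.InjOn (dualMap φ) f.coeff.support → ∀ y : ℝ, 0 < y → y ≤ 1 →
      normalizedHaar UnitAddCircle {t | ‖evalAt f (φ t)‖ ≤ y} ≤ ENNReal.ofReal (C * y ^ α) := by
  have hsupp : f.coeff.support.Nonempty := by
    rw [Finsupp.support_nonempty_iff]
    exact fun h => hf (MonoidAlgebra.coeff_injective h)
  obtain ⟨m, hm⟩ := Nat.exists_eq_succ_of_ne_zero (Finset.card_ne_zero.mpr hsupp)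
  obtain ⟨C, α, hC, hα, -, H⟩ := trigSum.exists_volume_sublevel_le (ι := Dual H) m
  refine ⟨C, α, hC, hα, fun φ hφ y hy0 hy1 => ?_⟩
  choose n hn using exists_char_eq_fourier
  have hninj : Function.Injective n := by
    intro χ ψ h
    refine PontryaginDual.ext fun x => Circle.ext ?_
    have h1 := hn χ x.toAdd
    rw [h, ← hn ψ] at h1
    exact h1
  obtain ⟨χ, hχ⟩ := hsupp
  -- Integrality enters here: a nonzero integer coefficient has modulus at least 1.
  have key := H f.coeff.support (fun χ => (f.coeff χ : ℂ)) (fun χ => n (dualMap φ χ)) hm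
    (hninj.comp_injOn hφ) ⟨χ, hχ, by
      rw [Complex.norm_intCast]
      exact_mod_cast Int.one_le_abs (Finsupp.mem_support_iff.mp hχ)⟩ y hy0 hy1
  have heval : ∀ t : ℝ, trigSum f.coeff.support (fun χ => (f.coeff χ : ℂ))
      (fun χ => n (dualMap φ χ)) t = evalAt f (φ (t : UnitAddCircle)) := by
    intro t
    rw [evalAt_eq_sum, trigSum]
    refine Finset.sum_congr rfl fun χ _ => ?_
    rw [← dualMap_apply, hn, fourier_coe_apply, Complex.ofReal_one, div_one]
  have hclosed : IsClosed {t : UnitAddCircle | ‖evalAt f (φ t)‖ ≤ y} :=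
    isClosed_le (((continuous_evalAt f).comp φ.continuous_toFun).norm) continuous_const
  rw [normalizedHaar_unitAddCircle,
    ← (UnitAddCircle.measurePreserving_mk 0).measure_preimage
      hclosed.measurableSet.nullMeasurableSet, Measure.restrict_apply'
      measurableSet_Ioc]
  refine (measure_mono ?_).trans key
  intro t ht
  refine ⟨by simpa using ht.2, ?_⟩
  rw [heval]
  exact ht.1

/-- The negative parts of the logarithms of the restrictions of an integral combination of
characters to one-parameter subgroups separating these characters are uniformly integrable. -/
theorem exists_lintegral_logNegPart_le {f : IntCharRing H} (hf : f ≠ 0) :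
    ∃ η : ℕ → ENNReal, Tendsto η atTop (𝓝 0) ∧ ∀ φ : UnitAddCircle →ₜ+ H,
      Set.InjOn (dualMap φ) f.coeff.support → ∀ A : ℕ,
      ∫⁻ t, logNegPart (evalAt f (φ t)) ∂normalizedHaar UnitAddCircle ≤
        (∫⁻ t, min (logNegPart (evalAt f (φ t))) A ∂normalizedHaar UnitAddCircle) + η A := by
  obtain ⟨C, α, hC, hα, h⟩ := exists_measure_sublevel_le hf
  let r : ℝ := Real.exp (-α)
  have hr1 : r < 1 := Real.exp_lt_one_iff.mpr (by linarith)
  have hr0 : 0 ≤ r := (Real.exp_pos _).le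
  -- The negative part exceeds `j` only where `‖f‖ ≤ exp (-j)`, a set of measure at most `C * r ^
  -- j`; `η` is the tail of this geometric series.
  refine ⟨fun A => ∑' j : ℕ, ENNReal.ofReal (C * r ^ (j + A)),
    ENNReal.tendsto_sum_nat_add (fun j => ENNReal.ofReal (C * r ^ j))
      ((summable_geometric_of_lt_one hr0 hr1).mul_left C).tsum_ofReal_ne_top,
    fun φ hφ A => ?_⟩
  have hcont : Continuous fun t => logNegPart (evalAt f (φ t)) :=
    continuous_logNegPart.comp ((continuous_evalAt f).comp φ.continuous_toFun)
  have hmeas : ∀ j : ℕ, MeasurableSet {t | ((j + A : ℕ) : ENNReal) < logNegPart (evalAt f (φ t))} :=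
    fun j => measurableSet_lt measurable_const hcont.measurable
  calc ∫⁻ t, logNegPart (evalAt f (φ t)) ∂normalizedHaar UnitAddCircle
      ≤ ∫⁻ t, (min (logNegPart (evalAt f (φ t))) A + ∑' j : ℕ,
          {t | ((j + A : ℕ) : ENNReal) < logNegPart (evalAt f (φ t))}.indicator 1 t)
          ∂normalizedHaar UnitAddCircle := by
        refine lintegral_mono fun t => (le_min_add_tsum _ A).trans (le_of_eq ?_)
        simp [Set.indicator_apply]
    _ = (∫⁻ t, min (logNegPart (evalAt f (φ t))) A ∂normalizedHaar UnitAddCircle) +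
          ∑' j : ℕ, normalizedHaar UnitAddCircle
            {t | ((j + A : ℕ) : ENNReal) < logNegPart (evalAt f (φ t))} := by
        rw [lintegral_add_left (hcont.min continuous_const).measurable, lintegral_tsum
          fun j => (measurable_one.indicator (hmeas j)).aemeasurable]
        simp only [lintegral_indicator_one (hmeas _)]
    _ ≤ _ := by
        refine add_le_add le_rfl (ENNReal.tsum_le_tsum fun j => ?_)
        refine (measure_mono fun t ht => norm_le_exp_neg_of_lt_logNegPart ht).trans
          ((h φ hφ _ (Real.exp_pos _)
            (Real.exp_le_one_iff.mpr (neg_nonpos.mpr (Nat.cast_nonneg _)))).trans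
            (le_of_eq ?_))
        rw [← Real.exp_mul, ← Real.exp_nat_mul]
        congr 3
        ring

end Tail

/-! ### Passage to the limit -/

section Limit

variable {k : ℕ}

theorem tendsto_lintegral_min (μ : Measure (Fin k → UnitAddCircle))
    {g : (Fin k → UnitAddCircle) → ENNReal} (hg : Measurable g) :
    Tendsto (fun A : ℕ => ∫⁻ x, min (g x) A ∂μ) atTop (𝓝 (∫⁻ x, g x ∂μ)) := by
  refine lintegral_tendsto_of_tendsto_of_monotone
    (fun A => (hg.min measurable_const).aemeasurable) (.of_forall fun x A B hAB => ?_)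
    (.of_forall fun x => ?_)
  · exact min_le_min_left _ (by exact_mod_cast hAB)
  · simpa using (tendsto_const_nhds (x := g x)).min ENNReal.tendsto_nat_nhds_top

/-- The integral of the negative part of `log |f|` over the torus is finite, and is the limit of the
integrals over the curves `t ↦ (t, N t, N² t, …)`. -/
theorem tendsto_lintegral_logNegPart_curve {f : IntCharRing (Fin k → UnitAddCircle)} (hf : f ≠ 0) :
    (∫⁻ x, logNegPart (evalAt f x) ∂normalizedHaar (Fin k → UnitAddCircle)) ≠ ⊤ ∧
    Tendsto (fun N : ℕ => ∫⁻ t, logNegPart (evalAt f (curve k N t)) ∂normalizedHaar UnitAddCircle)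
      atTop (𝓝 (∫⁻ x, logNegPart (evalAt f x) ∂normalizedHaar (Fin k → UnitAddCircle))) := by
  obtain ⟨η, hη, htail⟩ := exists_lintegral_logNegPart_le hf
  have hcont : Continuous fun x => logNegPart (evalAt f x) :=
    continuous_logNegPart.comp (continuous_evalAt f)
  set L := ∫⁻ x, logNegPart (evalAt f x) ∂normalizedHaar (Fin k → UnitAddCircle) with hL
  let LA : ℕ → ENNReal := fun A =>
    ∫⁻ x, min (logNegPart (evalAt f x)) A ∂normalizedHaar (Fin k → UnitAddCircle)
  let LN : ℕ → ENNReal := fun N =>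
    ∫⁻ t, logNegPart (evalAt f (curve k N t)) ∂normalizedHaar UnitAddCircle
  let LAN : ℕ → ℕ → ENNReal := fun A N =>
    ∫⁻ t, min (logNegPart (evalAt f (curve k N t))) A ∂normalizedHaar UnitAddCircle
  have hLA : Tendsto LA atTop (𝓝 L) := tendsto_lintegral_min _ hcont.measurable
  have hLAN : ∀ A, Tendsto (LAN A) atTop (𝓝 (LA A)) := fun A =>
    tendsto_lintegral_curve (hcont.min continuous_const)
      fun x => ne_top_of_le_ne_top (ENNReal.natCast_ne_top A) (min_le_right _ _)
  have hlow : ∀ A N, LAN A N ≤ LN N := fun A N => lintegral_mono fun t => min_le_left _ _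
  have hup : ∀ᶠ N in atTop, ∀ A, LN N ≤ LAN A N + η A := by
    filter_upwards [eventually_injOn_dualMap_curve f.coeff.support] with N hN A
    exact htail _ hN A
  have hLAle : ∀ A, LA A ≤ L := fun A => lintegral_mono fun t => min_le_left _ _
  -- Once `η A ≤ 1`, the integrals over the curves are eventually at most `A + 1`; this bounds every
  -- truncated integral over the torus.
  have hfin : L ≠ ⊤ := by
    obtain ⟨A, hA⟩ := (hη.eventually_le_const (zero_lt_one' ENNReal)).exists
    have hLANA : ∀ N, LAN A N ≤ A := fun N => by
      refine (lintegral_mono fun t => min_le_right _ _).trans ?_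
      simp
    have hLN : ∀ᶠ N in atTop, LN N ≤ A + 1 := by
      filter_upwards [hup] with N hN
      exact (hN A).trans (add_le_add (hLANA N) hA)
    have hLB : ∀ B, LA B ≤ A + 1 := fun B =>
      le_of_tendsto (hLAN B) (hLN.mono fun N hN => (hlow B N).trans hN)
    exact ne_top_of_le_ne_top (by finiteness) (le_of_tendsto' hLA hLB)
  refine ⟨hfin, tendsto_order.mpr ⟨fun b hb => ?_, fun b hb => ?_⟩⟩
  · obtain ⟨A, hA⟩ := (hLA.eventually_const_lt hb).exists
    filter_upwards [(hLAN A).eventually_const_lt hA] with N hN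
    exact hN.trans_le (hlow A N)
  · have h1 : Tendsto (fun A => L + η A) atTop (𝓝 (L + 0)) := hη.const_add L
    rw [add_zero] at h1
    obtain ⟨A, hA⟩ := (h1.eventually_lt_const hb).exists
    have h2 : Tendsto (fun N => LAN A N + η A) atTop (𝓝 (LA A + η A)) := (hLAN A).add_const _
    filter_upwards [hup, h2.eventually_lt_const ((add_le_add_left (hLAle A) _).trans_lt hA)]
      with N hN hN'
    exact (hN A).trans_lt hN'

/-- The logarithmic Mahler measure over the torus is a limit of logarithmic Mahler measures over
the circle. -/
theorem tendsto_logMahler_pullback_curve {f : IntCharRing (Fin k → UnitAddCircle)} (hf : f ≠ 0) :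
    Tendsto (fun N : ℕ => logMahler (pullback (curve k N) f)) atTop (𝓝 (logMahler f)) := by
  obtain ⟨hfin, hneg⟩ := tendsto_lintegral_logNegPart_curve hf
  have hpos := tendsto_lintegral_curve (continuous_logPosPart.comp (continuous_evalAt f))
    fun x => logPosPart_ne_top _
  simp only [logMahler_eq, evalAt_pullback, sub_eq_add_neg]
  have h1 := (continuous_coe_ennreal_ereal.tendsto _).comp hpos
  have h2 := ((continuous_coe_ennreal_ereal.tendsto _).comp hneg).neg
  -- Addition in `EReal` is continuous at this pair because the negative part has finite integral.
  refine (EReal.continuousAt_add (.inr ?_) (.inl ?_)).tendsto.comp (h1.prodMk_nhds h2)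
  · simpa [EReal.neg_eq_bot_iff] using hfin
  · exact EReal.coe_ennreal_ne_bot _

end Limit

/-! ### Comparison of the two constants -/

/-- A coordinate of the torus. -/
noncomputable def coordinate {k : ℕ} (i : Fin k) : (Fin k → UnitAddCircle) →ₜ+ UnitAddCircle where
  toFun x := x i
  map_zero' := rfl
  map_add' _ _ := rfl
  continuous_toFun := continuous_apply i

theorem measurePreserving_coordinate {k : ℕ} (i : Fin k) :
    MeasurePreserving (coordinate i) (normalizedHaar (Fin k → UnitAddCircle))
      (normalizedHaar UnitAddCircle) := by
  rw [normalizedHaar_torus, normalizedHaar_unitAddCircle]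
  exact measurePreserving_eval (fun _ => volume) i

end LehmerConstant

open LehmerConstant

theorem lemma3p1 (k : ℕ) (hk : 1 ≤ k) :
    LehmerConstant.lehmerConst (Fin k → UnitAddCircle) =
      LehmerConstant.lehmerConst UnitAddCircle := by
  refine le_antisymm (le_sInf ?_) (le_sInf ?_)
  · rintro _ ⟨f, rfl, hf⟩
    refine sInf_le ⟨pullback (coordinate ⟨0, hk⟩) f, ?_, hf⟩
    exact logMahler_pullback_of_measurePreserving _ (measurePreserving_coordinate _) f
  · rintro _ ⟨f, rfl, hf⟩
    have hf0 : f ≠ 0 := by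
      rintro rfl
      simp [logMahler_zero] at hf
    have h := tendsto_logMahler_pullback_curve hf0
    refine ge_of_tendsto h ?_
    -- Positivity of the limit makes the restrictions admissible in the infimum over the circle.
    filter_upwards [h.eventually_const_lt hf] with N hN
    exact sInf_le ⟨pullback (curve k N) f, rfl, hN⟩
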